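/- Let $(X,d)$ be a proper metric space (every closed ball is compact; in particular $X$ is complete and separable), let $p\in[1,\infty)$ and $r>0$, and let $\mathcal P(X)$ be the set of Borel probability measures on $X$. For $\mu_1,\mu_2\in\mathcal P(X)$ put $$W_p(\mu_1,\mu_2)=\inf_{\gamma\in\Gamma(\mu_1,\mu_2)}\Big(\int_{X\times X}d^p(x_1,x_2)\,\mathrm d\gamma(x_1,x_2)\Big)^{1/p}\in[0,\infty],$$ where $\Gamma(\mu_1,\mu_2)$ is the set of probability measures on $X\times X$ with marginals $\mu_1$ and $\mu_2$, and let $\mathcal B_r(\nu)=\{\mu\in\mathcal P(X):W_p(\mu,\nu)\le r\}$ for $\nu\in\mathcal P(X)$. Let $\nu\in\mathcal P(X)$ have a finite $p$-th moment, i.e. $\int_X d^p(x,x_0)\,\mathrm d\nu(x)<\infty$ for some $x_0\in X$, and let $f:X\to\mathbb R$ be upper semicontinuous. Assume that there exist $x_0\in X$, $c>0$ and $p'\in(0,p)$ such that $f(x)\le c\,[1+d^{p'}(x,x_0)]$ for all $x\in X$. Then $\int_X [f]_+\,\mathrm d\mu<\infty$ for every $\mu\in\mathcal B_r(\nu)$,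 so that $\int_X f\,\mathrm d\mu=\int_X[f]_+\,\mathrm d\mu-\int_X[-f]_+\,\mathrm d\mu$ is well defined in $[-\infty,\infty)$, and the optimal value $$\sup_{\mu\in\mathcal B_r(\nu)}\int_X f(x)\,\mathrm d\mu(x)$$ is attained: some $\mu^\star\in\mathcal B_r(\nu)$ satisfies $\int_X f\,\mathrm d\mu^\star=\sup_{\mu\in\mathcal B_r(\nu)}\int_X f\,\mathrm d\mu$. -/

import Mathlib

open MeasureTheory
open scoped ENNReal

noncomputable section

namespace WassersteinBall

/-- A Borel probability measure has a finite `p`-th moment if `∫ d(x, x₀)^p dμ < ∞` for some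
reference point `x₀`. -/
def HasFiniteMoment {X : Type*} [MetricSpace X] [MeasurableSpace X]
    (p : ℝ) (μ : ProbabilityMeasure X) : Prop :=
  ∃ x₀ : X, ∫⁻ x, edist x x₀ ^ p ∂(μ : Measure X) < ∞

/-- The set of all couplings of `μ₁` and `μ₂`: the probability measures on `X × X` with
marginals `μ₁` and `μ₂`. -/
def couplings {X : Type*} [MeasurableSpace X]
    (μ₁ μ₂ : ProbabilityMeasure X) : Set (ProbabilityMeasure (X × X)) :=
  {γ | (γ : Measure (X × X)).map Prod.fst = (μ₁ : Measure X) ∧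
       (γ : Measure (X × X)).map Prod.snd = (μ₂ : Measure X)}

/-- The `p`-th Wasserstein distance, with values in `[0, ∞]`, defined for all pairs of
probability measures (no moment condition). -/
def wassersteinDist {X : Type*} [MetricSpace X] [MeasurableSpace X]
    (p : ℝ) (μ₁ μ₂ : ProbabilityMeasure X) : ℝ≥0∞ :=
  ⨅ γ ∈ couplings μ₁ μ₂,
    (∫⁻ z, edist z.1 z.2 ^ p ∂(γ : Measure (X × X))) ^ (1 / p)

/-- The `p`-Wasserstein ball of radius `r` centred at `ν`. -/
def wassersteinBall {X : Type*} [MetricSpace X] [MeasurableSpace X]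
    (p r : ℝ) (ν : ProbabilityMeasure X) : Set (ProbabilityMeasure X) :=
  {μ | wassersteinDist p μ ν ≤ ENNReal.ofReal r}

/-- The integral `∫ f dμ = ∫ f₊ dμ - ∫ f₋ dμ` with values in `[-∞, ∞]`. It is meaningful
whenever at least one of the two parts is finite. -/
def extIntegral {X : Type*} [MeasurableSpace X]
    (f : X → ℝ) (μ : ProbabilityMeasure X) : EReal :=
  ((∫⁻ x, ENNReal.ofReal (f x) ∂(μ : Measure X) : ℝ≥0∞) : EReal) -
    ((∫⁻ x, ENNReal.ofReal (-f x) ∂(μ : Measure X) : ℝ≥0∞) : EReal)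

/-- The optimal value of maximizing `∫ f dμ` over the Wasserstein ball. -/
def optimalValue {X : Type*} [MetricSpace X] [MeasurableSpace X]
    (p r : ℝ) (ν : ProbabilityMeasure X) (f : X → ℝ) : EReal :=
  ⨆ μ ∈ wassersteinBall p r ν, extIntegral f μ

end WassersteinBall

end

/-!
The ball is parametrized by transport plans: `plans p R ν` is the set of measures on `X × X` with
second marginal `ν` and cost at most `R`. By the triangle inequality its elements have uniformly
bounded `p`-th moments, so it is tight because `X` is proper, and it is closed because the cost is
weakly lower semicontinuous (`isCompact_plans`). Compactness also gives optimal couplings, hence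
the Wasserstein ball is exactly the image of `plans p (r ^ p) ν` under the first marginal
(`mem_wassersteinBall_iff`), and it suffices to maximize over the compact set of plans.

What remains is the upper semicontinuity of `μ ↦ ∫ f dμ` on a set of measures with `p`-th moment at
most `C` (`upperSemicontinuousOn_extIntegral`). As `f` grows with an exponent `p' < p`, for each
`e > 0` there is a constant `A` with `f ≤ A + e * d(·, x₀) ^ p`. The functional
`A + e * C - ∫ (A + e * d(·, x₀) ^ p - f) dμ` is upper semicontinuous, because the integrand is
lower semicontinuous and nonnegative. For finite integrals it equals
`∫ f dμ + e * (C - ∫ d(·, x₀) ^ p dμ)`, so it lies between `∫ f dμ` and `∫ f dμ + e * C`. Thus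
`∫ f dμ` is an infimum of upper semicontinuous functionals
(`extIntegral_eq_iInf_penalizedIntegral`).
The identity persists when `∫ f dμ = -∞`, both sides being `-∞`.
-/

namespace WassersteinBall

open Filter Topology Set

/-! ### Weak lower semicontinuity and compactness -/

lemma edist_rpow_eq_ofReal {Y : Type*} [PseudoMetricSpace Y] {p : ℝ} (hp : 0 ≤ p) (y z : Y) :
    edist y z ^ p = ENNReal.ofReal (dist y z ^ p) := by
  rw [edist_dist, ENNReal.ofReal_rpow_of_nonneg dist_nonneg hp]

lemma map_eq_iff {Y Z : Type*} [MeasurableSpace Y] [MeasurableSpace Z]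
    {γ : ProbabilityMeasure Y} {μ : ProbabilityMeasure Z} {u : Y → Z}
    (hu : AEMeasurable u (γ : Measure Y)) :
    γ.map hu = μ ↔ (γ : Measure Y).map u = (μ : Measure Z) :=
  Subtype.ext_iff

/-- By the layer cake formula the integral is `∫ t in (0, ∞), μ {g > t}`; the sets `{g > t}` are
open, so the portmanteau theorem and Fatou's lemma apply. Fatou's lemma is available for the
neighbourhood filter of `μ` because the topology of weak convergence is metrizable here. -/
lemma lowerSemicontinuous_lintegral_ofReal {Y : Type*} [MetricSpace Y]
    [SecondCountableTopology Y] [MeasurableSpace Y] [BorelSpace Y] {g : Y → ℝ}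
    (hg : LowerSemicontinuous g) (h0 : ∀ y, 0 ≤ g y) :
    LowerSemicontinuous fun μ : ProbabilityMeasure Y =>
      ∫⁻ y, ENNReal.ofReal (g y) ∂(μ : Measure Y) := by
  rw [lowerSemicontinuous_iff_le_liminf]
  intro μ
  have key (μ : ProbabilityMeasure Y) : ∫⁻ y, ENNReal.ofReal (g y) ∂(μ : Measure Y) =
      ∫⁻ t in Ioi (0 : ℝ), (μ : Measure Y) {a | t < g a} :=
    lintegral_eq_lintegral_meas_lt _ (ae_of_all _ h0) hg.measurable.aemeasurable
  simp_rw [key]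
  refine le_trans (lintegral_mono fun t => ?_) (lintegral_liminf_le' fun μ => ?_)
  · exact ProbabilityMeasure.le_liminf_measure_open_of_tendsto tendsto_id (hg.isOpen_preimage t)
  · exact (Antitone.measurable fun s t hst =>
      measure_mono fun a (ha : t < g a) => lt_of_le_of_lt hst ha).aemeasurable

lemma lowerSemicontinuous_lintegral_rpow_edist {Y Z : Type*} [MetricSpace Y] [MetricSpace Z]
    [SecondCountableTopology Y] [MeasurableSpace Y] [BorelSpace Y] {p : ℝ} (hp : 0 ≤ p)
    {u v : Y → Z} (hu : Continuous u) (hv : Continuous v) :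
    LowerSemicontinuous fun μ : ProbabilityMeasure Y =>
      ∫⁻ y, edist (u y) (v y) ^ p ∂(μ : Measure Y) := by
  simp_rw [edist_rpow_eq_ofReal hp]
  refine lowerSemicontinuous_lintegral_ofReal
    (Continuous.lowerSemicontinuous ?_) fun y => by positivity
  exact (hu.dist hv).rpow_const fun _ => Or.inr hp

/-- Since closed balls are compact, Markov's inequality makes a family of measures with uniformly
bounded `p`-th moments tight, and Prokhorov's theorem applies. -/
lemma isCompact_setOf_moment_le {Y : Type*} [MetricSpace Y] [ProperSpace Y]
    [MeasurableSpace Y] [BorelSpace Y] {p : ℝ} (hp : 1 ≤ p) (y₀ : Y) {C : ℝ≥0∞} (hC : C ≠ ∞) :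
    IsCompact {μ : ProbabilityMeasure Y | ∫⁻ y, edist y y₀ ^ p ∂(μ : Measure Y) ≤ C} := by
  have hp0 : 0 ≤ p := by linarith
  set S := {μ : ProbabilityMeasure Y | ∫⁻ y, edist y y₀ ^ p ∂(μ : Measure Y) ≤ C}
  have hclosed : IsClosed S := (lowerSemicontinuous_lintegral_rpow_edist hp0
    continuous_id (continuous_const (y := y₀))).isClosed_preimage C
  rw [← hclosed.closure_eq]
  refine isCompact_closure_of_isTightMeasureSet ?_
  rw [isTightMeasureSet_iff_exists_isCompact_measure_compl_le]
  intro ε hε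
  obtain ⟨n, hn⟩ := ENNReal.exists_nat_gt (ENNReal.div_lt_top hC hε.ne').ne
  have hn0 : n ≠ 0 := by rintro rfl; simp at hn
  have hn1 : (1 : ℝ≥0∞) ≤ n := by exact_mod_cast Nat.one_le_iff_ne_zero.2 hn0
  refine ⟨Metric.closedBall y₀ n, isCompact_closedBall _ _, ?_⟩
  rintro _ ⟨μ, hμ, rfl⟩
  have hsub : (Metric.closedBall y₀ (n : ℝ))ᶜ ⊆ {y | (n : ℝ≥0∞) ≤ edist y y₀ ^ p} := by
    intro y hy
    have h1 : (n : ℝ≥0∞) ≤ edist y y₀ := by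
      rw [edist_dist, ← ENNReal.ofReal_natCast]
      have hlt : (n : ℝ) < dist y y₀ := by simpa using hy
      exact ENNReal.ofReal_le_ofReal hlt.le
    exact h1.trans (ENNReal.le_rpow_self_of_one_le (hn1.trans h1) hp)
  have hmeas : Measurable fun y : Y => edist y y₀ ^ p :=
    (measurable_id.edist measurable_const).pow_const p
  have hmarkov := (mul_meas_ge_le_lintegral (μ := (μ : Measure Y)) hmeas n).trans hμ
  calc (μ : Measure Y) (Metric.closedBall y₀ (n : ℝ))ᶜ
      ≤ (μ : Measure Y) {y | (n : ℝ≥0∞) ≤ edist y y₀ ^ p} := measure_mono hsub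
    _ ≤ C / n := by
        rw [ENNReal.le_div_iff_mul_le (by simp [hn0]) (by simp), mul_comm]
        exact hmarkov
    _ ≤ ε := by
        refine ENNReal.div_le_of_le_mul ?_
        rw [mul_comm]
        exact (ENNReal.div_le_iff_le_mul (Or.inl hε.ne') (Or.inr (by simpa using hn0))).1 hn.le

/-! ### Transport plans with one prescribed marginal -/

section Plans

variable {X : Type*} [MetricSpace X] [MeasurableSpace X]

/-- The probability measures on `X × X` with second marginal `ν` and `p`-th order transport cost
at most `R`; the first marginal is free. -/
def plans (p : ℝ) (R : ℝ≥0∞) (ν : ProbabilityMeasure X) : Set (ProbabilityMeasure (X × X)) :=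
  {γ | (γ : Measure (X × X)).map Prod.snd = (ν : Measure X) ∧
    ∫⁻ z, edist z.1 z.2 ^ p ∂(γ : Measure (X × X)) ≤ R}

lemma HasFiniteMoment.lintegral_lt_top {p : ℝ} (hp : 1 ≤ p)
    {ν : ProbabilityMeasure X} (hν : HasFiniteMoment p ν) (x₀ : X) :
    ∫⁻ x, edist x x₀ ^ p ∂(ν : Measure X) < ∞ := by
  obtain ⟨x₁, h₁⟩ := hν
  have hp0 : 0 ≤ p := by linarith
  calc ∫⁻ x, edist x x₀ ^ p ∂(ν : Measure X)
      ≤ ∫⁻ x, 2 ^ (p - 1) * (edist x x₁ ^ p + edist x₁ x₀ ^ p) ∂(ν : Measure X) :=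
        lintegral_mono fun x => (ENNReal.rpow_le_rpow (edist_triangle x x₁ x₀) hp0).trans
          (ENNReal.rpow_add_le_mul_rpow_add_rpow _ _ hp)
    _ = 2 ^ (p - 1) * (∫⁻ x, edist x x₁ ^ p ∂(ν : Measure X) + edist x₁ x₀ ^ p) := by
        rw [lintegral_const_mul' _ _ (by finiteness), lintegral_add_right _ measurable_const]
        simp
    _ < ∞ := by
        have : edist x₁ x₀ ^ p < ∞ := ENNReal.rpow_lt_top_of_nonneg hp0 (edist_ne_top _ _)
        finiteness

variable [SecondCountableTopology X] [BorelSpace X]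

/-- The `p`-th moments of the first marginals of the plans of cost at most `R` are uniformly
bounded. -/
lemma lintegral_fst_le_of_mem_plans {p : ℝ} (hp : 1 ≤ p) {R : ℝ≥0∞}
    {ν : ProbabilityMeasure X} (x₀ : X) {γ : ProbabilityMeasure (X × X)} (hγ : γ ∈ plans p R ν) :
    ∫⁻ z, edist z.1 x₀ ^ p ∂(γ : Measure (X × X)) ≤
      2 ^ (p - 1) * (R + ∫⁻ x, edist x x₀ ^ p ∂(ν : Measure X)) := by
  have hp0 : 0 ≤ p := by linarith
  calc ∫⁻ z, edist z.1 x₀ ^ p ∂(γ : Measure (X × X))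
      ≤ ∫⁻ z, 2 ^ (p - 1) * (edist z.1 z.2 ^ p + edist z.2 x₀ ^ p) ∂(γ : Measure (X × X)) :=
        lintegral_mono fun z => (ENNReal.rpow_le_rpow (edist_triangle z.1 z.2 x₀) hp0).trans
          (ENNReal.rpow_add_le_mul_rpow_add_rpow _ _ hp)
    _ = 2 ^ (p - 1) * (∫⁻ z, edist z.1 z.2 ^ p ∂(γ : Measure (X × X)) +
          ∫⁻ x, edist x x₀ ^ p ∂(ν : Measure X)) := by
        rw [lintegral_const_mul' _ _ (by finiteness), lintegral_add_left (by fun_prop), ← hγ.1,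
          lintegral_map (by fun_prop) measurable_snd]
    _ ≤ _ := by gcongr; exact hγ.2

lemma isCompact_plans [ProperSpace X] {p : ℝ} (hp : 1 ≤ p) {R : ℝ≥0∞} (hR : R ≠ ∞)
    {ν : ProbabilityMeasure X} (hν : HasFiniteMoment p ν) : IsCompact (plans p R ν) := by
  have hp0 : 0 ≤ p := by linarith
  obtain ⟨x₀, -⟩ := id hν
  have hm := hν.lintegral_lt_top hp x₀
  set m := ∫⁻ x, edist x x₀ ^ p ∂(ν : Measure X) with hm_def
  have hclosed : IsClosed (plans p R ν) := by
    have h1 : IsClosed {γ : ProbabilityMeasure (X × X) |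
        γ.map continuous_snd.measurable.aemeasurable = ν} :=
      isClosed_singleton.preimage (ProbabilityMeasure.continuous_map continuous_snd)
    have h2 := (lowerSemicontinuous_lintegral_rpow_edist (Y := X × X) hp0 continuous_fst
      continuous_snd).isClosed_preimage R
    convert h1.inter h2 using 1
    ext γ
    simp only [plans, mem_inter_iff, mem_ofPred_eq, mem_preimage, mem_Iic,
      map_eq_iff]
  refine (isCompact_setOf_moment_le (Y := X × X) hp (x₀, x₀)
    (C := 2 ^ (p - 1) * (R + m) + m) (by finiteness)).of_isClosed_subset hclosed fun γ hγ => ?_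
  calc ∫⁻ z, edist z (x₀, x₀) ^ p ∂(γ : Measure (X × X))
      ≤ ∫⁻ z, (edist z.1 x₀ ^ p + edist z.2 x₀ ^ p) ∂(γ : Measure (X × X)) := by
        refine lintegral_mono fun z => ?_
        rcases le_total (edist z.1 x₀) (edist z.2 x₀) with h | h
        · simp [Prod.edist_eq, h]
        · simp [Prod.edist_eq, h]
    _ ≤ _ := by
        rw [lintegral_add_left (by fun_prop)]
        gcongr
        · exact lintegral_fst_le_of_mem_plans hp x₀ hγ
        · rw [hm_def, ← hγ.1, lintegral_map (by fun_prop) measurable_snd]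

/-- The infimum defining the Wasserstein distance is attained, so that the ball of radius `r` is
the set of first marginals of the plans of cost at most `r ^ p`. -/
lemma mem_wassersteinBall_iff [ProperSpace X] {p : ℝ} (hp : 1 ≤ p) {r : ℝ} (hr : 0 ≤ r)
    {ν : ProbabilityMeasure X} (hν : HasFiniteMoment p ν) {μ : ProbabilityMeasure X} :
    μ ∈ wassersteinBall p r ν ↔ ∃ γ ∈ plans p (ENNReal.ofReal r ^ p) ν,
      γ.map continuous_fst.measurable.aemeasurable = μ := by
  have hp0 : 0 < p := by linarith
  have hfst (γ : ProbabilityMeasure (X × X)) :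
      γ.map continuous_fst.measurable.aemeasurable = μ ↔
        (γ : Measure (X × X)).map Prod.fst = (μ : Measure X) := map_eq_iff _
  have hpow (a b : ℝ≥0∞) : a ^ (1 / p) ≤ b ↔ a ≤ b ^ p := by
    rw [one_div, ENNReal.rpow_inv_le_iff hp0]
  constructor
  · intro hμ
    -- Some plan has cost at most `(r + 1) ^ p`, so an optimal one is found in a compact set.
    set T := plans p (ENNReal.ofReal (r + 1) ^ p) ν ∩
      {γ | γ.map continuous_fst.measurable.aemeasurable = μ}
    have hTc : IsCompact T := (isCompact_plans hp (by finiteness) hν).inter_right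
      (isClosed_singleton.preimage (ProbabilityMeasure.continuous_map continuous_fst))
    have hTne : T.Nonempty := by
      have hlt : wassersteinDist p μ ν < ENNReal.ofReal (r + 1) :=
        lt_of_le_of_lt hμ ((ENNReal.ofReal_lt_ofReal_iff (by linarith)).2 (by linarith))
      simp only [wassersteinDist, iInf_lt_iff] at hlt
      obtain ⟨γ, hγ, hlt⟩ := hlt
      exact ⟨γ, ⟨hγ.2, (hpow _ _).1 hlt.le⟩, (hfst γ).2 hγ.1⟩
    obtain ⟨γ₀, hγ₀, hmin⟩ := ((lowerSemicontinuous_lintegral_rpow_edist (Y := X × X) hp0.le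
      continuous_fst continuous_snd).lowerSemicontinuousOn T).exists_isMinOn hTne hTc
    refine ⟨γ₀, ⟨hγ₀.1.1, (hpow _ _).1 (le_trans (le_iInf₂ fun γ hγ => ?_) hμ)⟩, hγ₀.2⟩
    refine ENNReal.rpow_le_rpow ?_ (by positivity)
    by_cases hc : ∫⁻ z, edist z.1 z.2 ^ p ∂(γ : Measure (X × X)) ≤ ENNReal.ofReal (r + 1) ^ p
    · exact hmin (show γ ∈ T from ⟨⟨hγ.2, hc⟩, (hfst γ).2 hγ.1⟩)
    · exact hγ₀.1.2.trans (not_le.1 hc).le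
  · rintro ⟨γ, hγ, hμ⟩
    exact (iInf₂_le (f := fun (γ : ProbabilityMeasure (X × X)) (_ : γ ∈ couplings μ ν) =>
      (∫⁻ z, edist z.1 z.2 ^ p ∂(γ : Measure (X × X))) ^ (1 / p)) γ
      ⟨(hfst γ).1 hμ, hγ.1⟩).trans ((hpow _ _).2 hγ.2)

end Plans

/-! ### Upper semicontinuity of the integral on sets of bounded moment -/

/-- Growth of order `p' < p` is dominated by an arbitrarily small multiple of `d(·, x₀) ^ p`, up to
an additive constant. -/
lemma exists_forall_le_add_mul_rpow_dist {X : Type*} [MetricSpace X] {f : X → ℝ} {x₀ : X}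
    {c p p' : ℝ} (hc : 0 < c) (hp' : 0 < p') (hpp : p' < p)
    (hf : ∀ x, f x ≤ c * (1 + dist x x₀ ^ p')) {e : ℝ} (he : 0 < e) :
    ∃ A, 0 ≤ A ∧ ∀ x, f x ≤ A + e * dist x x₀ ^ p := by
  have hlim : Tendsto (fun t : ℝ => t ^ (-(p - p'))) atTop (𝓝 0) :=
    tendsto_rpow_neg_atTop (by linarith)
  obtain ⟨t, ht, ht1⟩ := ((hlim.eventually_le_const (show 0 < e / c by positivity)).and
    (eventually_ge_atTop 1)).exists
  refine ⟨c * (1 + t ^ p'), by positivity, fun x => (hf x).trans ?_⟩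
  have hd : (0 : ℝ) ≤ dist x x₀ := dist_nonneg
  rcases le_total (dist x x₀) t with h | h
  · have h1 : dist x x₀ ^ p' ≤ t ^ p' := Real.rpow_le_rpow hd h hp'.le
    have h2 : 0 ≤ e * dist x x₀ ^ p := by positivity
    nlinarith
  · have hd1 : 0 < dist x x₀ := by linarith
    have h1 : dist x x₀ ^ p' ≤ e / c * dist x x₀ ^ p := by
      calc dist x x₀ ^ p' = dist x x₀ ^ (-(p - p')) * dist x x₀ ^ p := by
            rw [← Real.rpow_add hd1]; ring_nf
        _ ≤ t ^ (-(p - p')) * dist x x₀ ^ p := by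
            gcongr ?_ * _
            exact Real.rpow_le_rpow_of_nonpos (by linarith) h (by linarith)
        _ ≤ e / c * dist x x₀ ^ p := by gcongr
    have h2 : 0 ≤ t ^ p' := by positivity
    calc c * (1 + dist x x₀ ^ p') ≤ c * (1 + e / c * dist x x₀ ^ p) := by gcongr
      _ = c + e * dist x x₀ ^ p := by field_simp
      _ ≤ _ := by nlinarith

lemma extIntegral_eq_coe_integral {X : Type*} [MeasurableSpace X] {f : X → ℝ}
    {μ : ProbabilityMeasure X} (hf : Integrable f (μ : Measure X)) :
    extIntegral f μ = ((∫ x, f x ∂(μ : Measure X) : ℝ) : EReal) := by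
  have h1 := hf.lintegral_lt_top
  have h2 : ∫⁻ x, ENNReal.ofReal (-f x) ∂(μ : Measure X) < ∞ := hf.neg.lintegral_lt_top
  rw [extIntegral, integral_eq_lintegral_pos_part_sub_lintegral_neg_part hf, EReal.coe_sub,
    EReal.coe_ennreal_toReal h1.ne, EReal.coe_ennreal_toReal h2.ne]

section Integrals

variable {X : Type*} [MetricSpace X] [MeasurableSpace X] {f : X → ℝ} {x₀ : X} {p : ℝ}
  {μ : ProbabilityMeasure X}

lemma lintegral_ofReal_lt_top_of_le {A e : ℝ} (hA : 0 ≤ A) (he : 0 ≤ e)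
    (hf : ∀ x, f x ≤ A + e * dist x x₀ ^ p)
    (hd : Integrable (fun x => dist x x₀ ^ p) (μ : Measure X)) :
    ∫⁻ x, ENNReal.ofReal (f x) ∂(μ : Measure X) < ∞ := by
  have hi := (integrable_const (μ := (μ : Measure X)) A).add (hd.const_mul e)
  refine (lintegral_mono fun x => ENNReal.ofReal_le_ofReal (hf x)).trans_lt ?_
  exact (hasFiniteIntegral_iff_ofReal (ae_of_all _ fun x => by
    simp only [Pi.zero_apply]; positivity)).1 hi.2

/-- A version of `∫ f dμ + e * (C - ∫ d(x, x₀) ^ p dμ)` that is meaningful for every probability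
measure `μ`, provided that `f ≤ A + e * d(·, x₀) ^ p`: the integrand of the subtracted term is then
nonnegative. -/
noncomputable def penalizedIntegral (f : X → ℝ) (x₀ : X) (p C A e : ℝ)
    (μ : ProbabilityMeasure X) : EReal :=
  ((A + e * C : ℝ) : EReal) -
    ((∫⁻ x, ENNReal.ofReal (A + e * dist x x₀ ^ p - f x) ∂(μ : Measure X) : ℝ≥0∞) : EReal)

/-- The constant `A` cancels. -/
lemma penalizedIntegral_eq_coe {C A e : ℝ} (hfle : ∀ x, f x ≤ A + e * dist x x₀ ^ p)
    (hf : Integrable f (μ : Measure X))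
    (hd : Integrable (fun x => dist x x₀ ^ p) (μ : Measure X)) :
    penalizedIntegral f x₀ p C A e μ =
      ((∫ x, f x ∂(μ : Measure X) + e * (C - ∫ x, dist x x₀ ^ p ∂(μ : Measure X)) : ℝ) :
        EReal) := by
  have h1 : Integrable (fun x => A + e * dist x x₀ ^ p) (μ : Measure X) :=
    (integrable_const A).add (hd.const_mul e)
  have h3 : Integrable (fun x => A + e * dist x x₀ ^ p - f x) (μ : Measure X) := h1.sub hf
  have h0 : 0 ≤ᵐ[(μ : Measure X)] fun x => A + e * dist x x₀ ^ p - f x :=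
    ae_of_all _ fun x => sub_nonneg.2 (hfle x)
  have h2 : ∫ x, (A + e * dist x x₀ ^ p - f x) ∂(μ : Measure X) =
      A + e * ∫ x, dist x x₀ ^ p ∂(μ : Measure X) - ∫ x, f x ∂(μ : Measure X) := by
    rw [integral_sub h1 hf, integral_add (integrable_const A) (hd.const_mul e),
      integral_const_mul]
    simp
  rw [penalizedIntegral, ← ofReal_integral_eq_lintegral_ofReal h3 h0,
    EReal.coe_ennreal_ofReal, max_eq_left (integral_nonneg_of_ae h0), ← EReal.coe_sub, h2]
  congr 1
  ring

variable [SecondCountableTopology X] [BorelSpace X]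

lemma integrable_rpow_dist (hp : 0 ≤ p) (hμ : ∫⁻ x, edist x x₀ ^ p ∂(μ : Measure X) < ∞) :
    Integrable (fun x => dist x x₀ ^ p) (μ : Measure X) := by
  simp_rw [edist_rpow_eq_ofReal hp] at hμ
  refine ⟨by fun_prop, ?_⟩
  rwa [hasFiniteIntegral_iff_ofReal (ae_of_all _ fun x => by positivity)]

lemma upperSemicontinuous_penalizedIntegral (hp : 0 ≤ p) (hf : UpperSemicontinuous f) {C A e : ℝ}
    (hfle : ∀ x, f x ≤ A + e * dist x x₀ ^ p) :
    UpperSemicontinuous (penalizedIntegral f x₀ p C A e) := by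
  have hlsc : LowerSemicontinuous fun x => A + e * dist x x₀ ^ p - f x := by
    simp_rw [sub_eq_add_neg]
    refine LowerSemicontinuous.add (Continuous.lowerSemicontinuous ?_)
      (continuous_neg.comp_upperSemicontinuous_antitone hf fun a b h => neg_le_neg h)
    exact continuous_const.add (continuous_const.mul
      ((continuous_id.dist continuous_const).rpow_const fun _ => Or.inr hp))
  have hcont : Continuous fun a : ℝ≥0∞ => ((A + e * C : ℝ) : EReal) - (a : EReal) := by
    rw [continuous_iff_continuousAt]
    intro a
    simp_rw [sub_eq_add_neg]
    exact ContinuousAt.comp (f := fun a : ℝ≥0∞ => (((A + e * C : ℝ) : EReal), -(a : EReal)))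
      (EReal.continuousAt_add (Or.inl (EReal.coe_ne_top _)) (Or.inl (EReal.coe_ne_bot _)))
      (continuousAt_const.prodMk continuous_coe_ennreal_ereal.neg.continuousAt)
  exact hcont.comp_lowerSemicontinuous_antitone
    (lowerSemicontinuous_lintegral_ofReal hlsc fun x => sub_nonneg.2 (hfle x))
    fun a b hab => EReal.sub_le_sub le_rfl (by exact_mod_cast hab)

/-- If the `p`-th moment of `μ` is at most `C`, every penalized integral is at least the integral
of `f`, and exceeds it by at most `e n * C` when that integral is finite. -/
lemma extIntegral_eq_iInf_penalizedIntegral (hp : 0 ≤ p) (hf : UpperSemicontinuous f) {C : ℝ}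
    (hC : 0 ≤ C) (hμ : ∫⁻ x, edist x x₀ ^ p ∂(μ : Measure X) ≤ ENNReal.ofReal C)
    {A e : ℕ → ℝ} (hA : ∀ n, 0 ≤ A n) (he : ∀ n, 0 ≤ e n) (helim : Tendsto e atTop (𝓝 0))
    (hfle : ∀ n x, f x ≤ A n + e n * dist x x₀ ^ p) :
    extIntegral f μ = ⨅ n, penalizedIntegral f x₀ p C (A n) (e n) μ := by
  have hd := integrable_rpow_dist hp (hμ.trans_lt ENNReal.ofReal_lt_top)
  have hpos := lintegral_ofReal_lt_top_of_le (hA 0) (he 0) (hfle 0) hd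
  have hfm : Measurable f := hf.measurable
  by_cases hneg : ∫⁻ x, ENNReal.ofReal (-f x) ∂(μ : Measure X) = ∞
  · -- Both sides equal `-∞`, since `A n + e n * d ^ p - f ≥ -f`.
    have hbot (n : ℕ) : penalizedIntegral f x₀ p C (A n) (e n) μ = ⊥ := by
      have : ∫⁻ x, ENNReal.ofReal (A n + e n * dist x x₀ ^ p - f x) ∂(μ : Measure X) = ∞ := by
        refine top_le_iff.1 (hneg.symm.trans_le (lintegral_mono fun x => ?_))
        have := mul_nonneg (he n) (Real.rpow_nonneg (dist_nonneg (x := x) (y := x₀)) p)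
        have := hA n
        exact ENNReal.ofReal_le_ofReal (by linarith)
      rw [penalizedIntegral, this, EReal.coe_ennreal_top, EReal.sub_top]
    simp [hbot, extIntegral, hneg]
  · have hfi : Integrable f (μ : Measure X) := by
      refine ⟨hfm.aestronglyMeasurable, ?_⟩
      rw [hasFiniteIntegral_iff_norm]
      calc ∫⁻ x, ENNReal.ofReal ‖f x‖ ∂(μ : Measure X)
          ≤ ∫⁻ x, (ENNReal.ofReal (f x) + ENNReal.ofReal (-f x)) ∂(μ : Measure X) := by
            refine lintegral_mono fun x => ?_
            rcases abs_cases (f x) with h | h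
            · rw [Real.norm_eq_abs, h.1]; exact le_self_add
            · rw [Real.norm_eq_abs, h.1]; exact le_add_self
        _ < ∞ := by
            rw [lintegral_add_left hfm.ennreal_ofReal]
            exact ENNReal.add_lt_top.2 ⟨hpos, lt_top_iff_ne_top.2 hneg⟩
    have hm : ∫ x, dist x x₀ ^ p ∂(μ : Measure X) ≤ C := by
      have h0 : 0 ≤ᵐ[(μ : Measure X)] fun x => dist x x₀ ^ p :=
        ae_of_all _ fun x => by positivity
      simp_rw [edist_rpow_eq_ofReal hp] at hμ
      rwa [← ofReal_integral_eq_lintegral_ofReal hd h0, ENNReal.ofReal_le_ofReal_iff hC] at hμ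
    simp_rw [extIntegral_eq_coe_integral hfi,
      fun n => penalizedIntegral_eq_coe (C := C) (hfle n) hfi hd]
    set J := ∫ x, f x ∂(μ : Measure X)
    set m := ∫ x, dist x x₀ ^ p ∂(μ : Measure X)
    refine le_antisymm (le_iInf fun n => EReal.coe_le_coe_iff.2 ?_) ?_
    · have := mul_nonneg (he n) (sub_nonneg.2 hm)
      linarith
    · have hlim : Tendsto (fun n => ((J + e n * (C - m) : ℝ) : EReal)) atTop (𝓝 (J : EReal)) := by
        refine (continuous_coe_real_ereal.tendsto _).comp ?_
        simpa using (helim.mul_const (C - m)).const_add J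
      exact ge_of_tendsto' hlim fun n => iInf_le _ n

lemma upperSemicontinuousOn_extIntegral (hp : 0 ≤ p) (hf : UpperSemicontinuous f) {C : ℝ}
    (hC : 0 ≤ C)
    (hfle : ∀ e : ℝ, 0 < e → ∃ A, 0 ≤ A ∧ ∀ x, f x ≤ A + e * dist x x₀ ^ p) :
    UpperSemicontinuousOn (extIntegral f)
      {μ : ProbabilityMeasure X | ∫⁻ x, edist x x₀ ^ p ∂(μ : Measure X) ≤ ENNReal.ofReal C} := by
  choose A hA hfle using fun n : ℕ => hfle (1 / ((n : ℝ) + 1)) (by positivity)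
  have husc : UpperSemicontinuous fun μ =>
      ⨅ n : ℕ, penalizedIntegral f x₀ p C (A n) (1 / ((n : ℝ) + 1)) μ :=
    upperSemicontinuous_iInf fun n => upperSemicontinuous_penalizedIntegral hp hf (hfle n)
  intro μ hμ
  refine (husc.upperSemicontinuousOn _ μ hμ).congr_of_eventuallyEq hμ ?_
  filter_upwards [self_mem_nhdsWithin] with μ' hμ'
  intro y
  rw [extIntegral_eq_iInf_penalizedIntegral hp hf hC hμ' hA (fun n => by positivity)
    tendsto_one_div_add_atTop_nhds_zero_nat hfle]

end Integrals

end WassersteinBall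

/-! ### Maximization over the ball -/

open WassersteinBall Set in
theorem theorem3 {X : Type*} [MetricSpace X] [ProperSpace X]
    [MeasurableSpace X] [BorelSpace X]
    (p : ℝ) (hp : 1 ≤ p) (r : ℝ) (hr : 0 < r)
    (ν : ProbabilityMeasure X) (hν : WassersteinBall.HasFiniteMoment p ν)
    (f : X → ℝ) (hf : UpperSemicontinuous f)
    (hgrowth : ∃ x₀ : X, ∃ c : ℝ, 0 < c ∧ ∃ p' : ℝ, 0 < p' ∧ p' < p ∧
      ∀ x : X, f x ≤ c * (1 + dist x x₀ ^ p')) :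
    (∀ μ ∈ WassersteinBall.wassersteinBall p r ν,
      ∫⁻ x, ENNReal.ofReal (f x) ∂(μ : Measure X) < ∞) ∧
    ∃ μ ∈ WassersteinBall.wassersteinBall p r ν,
      WassersteinBall.extIntegral f μ = WassersteinBall.optimalValue p r ν f := by
  have hp0 : 0 ≤ p := by linarith
  obtain ⟨x₀, c, hc, p', hp', hpp, hle⟩ := hgrowth
  have hbound (e : ℝ) (he : 0 < e) := exists_forall_le_add_mul_rpow_dist hc hp' hpp hle he
  have hmom := hν.lintegral_lt_top hp x₀
  set K := plans p (ENNReal.ofReal r ^ p) ν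
  set M : ℝ≥0∞ := 2 ^ (p - 1) * (ENNReal.ofReal r ^ p + ∫⁻ x, edist x x₀ ^ p ∂(ν : Measure X))
  have hM_top : M ≠ ∞ := by finiteness
  let φ : ProbabilityMeasure (X × X) → ProbabilityMeasure X :=
    fun γ => γ.map continuous_fst.measurable.aemeasurable
  have hφ : Continuous φ := ProbabilityMeasure.continuous_map continuous_fst
  have hball (μ : ProbabilityMeasure X) : μ ∈ wassersteinBall p r ν ↔ ∃ γ ∈ K, φ γ = μ :=
    mem_wassersteinBall_iff hp hr.le hν
  have hmaps : MapsTo φ K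
      {μ | ∫⁻ x, edist x x₀ ^ p ∂(μ : Measure X) ≤ ENNReal.ofReal M.toReal} := by
    intro γ hγ
    rw [mem_ofPred_eq, ENNReal.ofReal_toReal hM_top]
    refine le_trans (le_of_eq ?_) (lintegral_fst_le_of_mem_plans hp x₀ hγ)
    exact lintegral_map (f := fun x => edist x x₀ ^ p) (by fun_prop) measurable_fst
  constructor
  · intro μ hμ
    obtain ⟨γ, hγ, rfl⟩ := (hball μ).1 hμ
    obtain ⟨A, hA, hA'⟩ := hbound 1 one_pos
    exact lintegral_ofReal_lt_top_of_le hA zero_le_one hA'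
      (integrable_rpow_dist hp0 ((hmaps hγ).trans_lt ENNReal.ofReal_lt_top))
  · -- The diagonal coupling of `ν` with itself has cost zero.
    have hKne : K.Nonempty := by
      refine ⟨ν.map (f := fun x => (x, x)) (by fun_prop), ?_, ?_⟩
      · exact (Measure.map_map measurable_snd (by fun_prop)).trans Measure.map_id
      · refine le_trans (le_of_eq ?_) zero_le
        refine (lintegral_map (f := fun z : X × X => edist z.1 z.2 ^ p) (by fun_prop)
          (by fun_prop)).trans ?_
        simp [ENNReal.zero_rpow_of_pos (show 0 < p by linarith)]
    have husc : UpperSemicontinuousOn (fun γ => extIntegral f (φ γ)) K :=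
      (upperSemicontinuousOn_extIntegral hp0 hf ENNReal.toReal_nonneg hbound).comp
        hφ.continuousOn hmaps
    obtain ⟨γ, hγ, hmax⟩ := husc.exists_isMaxOn hKne (isCompact_plans hp (by finiteness) hν)
    have hmem := (hball (φ γ)).2 ⟨γ, hγ, rfl⟩
    refine ⟨φ γ, hmem, le_antisymm (le_iSup₂ (f := fun μ _ => extIntegral f μ) (φ γ) hmem)
      (iSup₂_le fun μ hμ => ?_)⟩
    obtain ⟨γ', hγ', rfl⟩ := (hball μ).1 hμ
    exact hmax hγ'
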